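/- Let $I\subseteq\mathbb R$ be a nonempty open set (for instance an open interval) and let $\mathbf r:I\to\mathbb R^3$ be a rational helix: the coordinates of $\mathbf r$ are rational functions without poles in $I$, and $\mathbf r'(t)=\sigma(t)\,\mathbf t(t)$ on $I$, where $\sigma$ is a rational function that does not vanish identically, the unit tangent $\mathbf t$ is a rational vector field with $|\mathbf t(t)|=1$ for all $t\in I$, and $\mathbf t$ makes a constant angle with a fixed direction and is not contained in a great circle: $\mathbf t(t)\cdot\mathbf u=\cos\psi$ for all $t\in I$, with a constant unit vector $\mathbf u$ and a constant $\psi\in(0,\pi)$, $\psi\neq\pi/2$. Suppose that $\mathbf t$ has degree $2$, that is, $\mathbf t=(p_1,p_2,p_3)/q$ with real polynomials $p_1,p_2,p_3,q$ without a common factor of positive degree, the largest of whose degrees is $2$. Then $\mathbf r$ admits no rational rotation-minimizing frame on $I$: there are no rational vector fields $\mathbf f_1,\mathbf f_2,\mathbf f_3$, without poles in $I$, such that for all $t\in I$ the vectors $\mathbf f_1(t),\mathbf f_2(t),\mathbf f_3(t)$ form an orthonormal basis of $\mathbb R^3$, $\mathbf f_1$ is a unit tangent of $\mathbf r$ (that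 is, $\mathbf r'=\rho\,\mathbf f_1$ on $I$ for some rational function $\rho$ that does not vanish identically), and $\mathbf f_2'(t)\cdot\mathbf f_3(t)=0$. -/

import Mathlib

/-- Euclidean three-space. -/
abbrev Space3 : Type := EuclideanSpace ℝ (Fin 3)

/-- A scalar function that is given on `I` by a rational function without poles in `I`. -/
def IsRationalOn (I : Set ℝ) (f : ℝ → ℝ) : Prop :=
  ∃ p q : Polynomial ℝ, ∀ t ∈ I, q.eval t ≠ 0 ∧ f t = p.eval t / q.eval t

/-- A vector function all of whose coordinates are rational on `I`. -/
def IsRationalVecOn (I : Set ℝ) (v : ℝ → Space3) : Prop :=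
  ∀ i : Fin 3, IsRationalOn I (fun t => v t i)

/-- `v` is on `I` a rational vector field of degree `d`: it is `(p₀, p₁, p₂) / q` in lowest terms
(the four polynomials have no common factor), and the largest of the four degrees is `d`. -/
def HasRationalDegreeOn (I : Set ℝ) (v : ℝ → Space3) (d : ℕ) : Prop :=
  ∃ (p : Fin 3 → Polynomial ℝ) (q : Polynomial ℝ),
    (∀ g : Polynomial ℝ, g ∣ q → (∀ i, g ∣ p i) → IsUnit g) ∧
    max q.natDegree (Finset.univ.sup fun i => (p i).natDegree) = d ∧
    ∀ t ∈ I, q.eval t ≠ 0 ∧ ∀ i, v t i = (p i).eval t / q.eval t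

/-- `T` is a unit tangent field of the curve `r` on `I`: `|T| = 1` and `r' = σ T`, where the scalar
speed `σ` is a rational function that does not vanish identically. Where `r' ≠ 0` this says
`T = ± r' / |r'|`; isolated cusps (zeros of `σ`) are allowed. -/
def IsUnitTangentOn (I : Set ℝ) (r T : ℝ → Space3) : Prop :=
  (∀ t ∈ I, ‖T t‖ = 1) ∧
  ∃ σ : ℝ → ℝ, IsRationalOn I σ ∧ (∃ t ∈ I, σ t ≠ 0) ∧ ∀ t ∈ I, HasDerivAt r (σ t • T t) t

/-- `r` is on `I` a rational helix with unit tangent `T`: a rational curve with rational unit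
tangent that makes a constant angle `ψ` with a fixed unit vector `u` and so runs in a small circle
of the unit sphere (neither a single point, `ψ = 0, π`, nor a great circle, `ψ = π / 2`). -/
structure IsRationalHelixOn (I : Set ℝ) (r T : ℝ → Space3) : Prop where
  rational_curve : IsRationalVecOn I r
  rational_tangent : IsRationalVecOn I T
  tangent : IsUnitTangentOn I r T
  constant_angle : ∃ (u : Space3) (ψ : ℝ), ‖u‖ = 1 ∧ 0 < ψ ∧ ψ < Real.pi ∧ ψ ≠ Real.pi / 2 ∧
    ∀ t ∈ I, inner ℝ (T t) u = Real.cos ψ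

/-- `(f 0, f 1, f 2)` is on `I` a rational rotation-minimizing frame of `r`: a rational orthonormal
frame, adapted (`f 0` is a unit tangent), with `f₁' · f₂ = 0`. -/
structure IsRRMFOn (I : Set ℝ) (r : ℝ → Space3) (f : Fin 3 → ℝ → Space3) : Prop where
  rational : ∀ k, IsRationalVecOn I (f k)
  orthonormal : ∀ t ∈ I, Orthonormal ℝ (fun k => f k t)
  adapted : IsUnitTangentOn I r (f 0)
  rotation_minimizing : ∀ t ∈ I, inner ℝ (deriv (f 1) t) (f 2 t) = 0

/-!
Let the tangent be `p / q`, with `p ⬝ p = q ^ 2` and `u ⬝ p = c q`; then `q` is an irreducible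
quadratic. Differentiating `p ⬝ p = q ^ 2` three times shows that `p' ⬝ p' - q' ^ 2` is a constant.
At a complex root `z` of `q`, the vectors `p z` and `p' z - c (q' z) u` lie in the plane orthogonal
to `u`, the first is isotropic and nonzero, and they are orthogonal to each other, so the second is
isotropic too: the constant is `-(1 - c ^ 2) (q' z) ^ 2`.

In a rotation-minimizing frame, the components `g₁`, `g₂` of `u` along the normal vectors satisfy
`g₁ ^ 2 + g₂ ^ 2 = 1 - c ^ 2`, and the square of `g₁ g₂' - g₁' g₂` is `c ^ 2 (1 - c ^ 2)` times the
squared speed of the tangent. Hence the logarithmic derivative of `g₁ + i g₂`, which is rational,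
equals `± c (q' z) / q` and has residue `± c` at `z`. Residues of logarithmic derivatives are
integers, and `|c| < 1` because the tangent is not constant, so `c = 0`.
-/

open Polynomial Filter Matrix Topology Module

theorem degree_le_of_isBigO_eval_atTop {p q : ℝ[X]} (h : p.eval =O[atTop] q.eval) :
    p.degree ≤ q.degree := by
  by_contra! hlt
  have hp : p ≠ 0 := by
    rintro rfl
    simp at hlt
  exact Asymptotics.isLittleO_irrefl (p.eventually_atTop_not_isRoot hp).frequently
    (h.trans_isLittleO (isLittleO_atTop_of_degree_lt q p hlt))

theorem natDegree_le_of_sum_sq_eq_sq {ι : Type*} [Fintype ι] {p : ι → ℝ[X]} {q : ℝ[X]}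
    (h : ∑ i, p i ^ 2 = q ^ 2) (i : ι) : (p i).natDegree ≤ q.natDegree := by
  refine natDegree_le_natDegree (degree_le_of_isBigO_eval_atTop ?_)
  refine .of_bound' (.of_forall fun t => ?_)
  have heval : ∑ j, (p j).eval t ^ 2 = q.eval t ^ 2 := by
    simpa [eval_finsetSum] using congrArg (eval t) h
  rw [Real.norm_eq_abs, Real.norm_eq_abs, ← sq_le_sq, ← heval]
  exact Finset.single_le_sum (fun j _ => sq_nonneg ((p j).eval t)) (Finset.mem_univ i)

theorem X_sub_C_mul_wronskian_pow_mul {R : Type*} [CommRing R] (z : R) (m n : ℕ) (p q : R[X]) :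
    (X - C z) * wronskian ((X - C z) ^ n * q) ((X - C z) ^ m * p) =
      (X - C z) ^ (m + n) * (C (m - n : R) * (p * q) + (X - C z) * wronskian q p) := by
  have hderiv : ∀ (k : ℕ) (r : R[X]), (X - C z) * derivative ((X - C z) ^ k * r) =
      (X - C z) ^ k * (C (k : R) * r + (X - C z) * derivative r) := by
    rintro (_ | k) r
    · simp
    · simp [derivative_pow]
      ring
  simp only [wronskian, C_sub]
  linear_combination (X - C z) ^ n * q * hderiv m p - (X - C z) ^ m * p * hderiv n q

/- The residue at `z` of the logarithmic derivative `wronskian q p / (p * q)` of `p / q` is the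
order of `p / q` at `z`. -/
theorem rootMultiplicity_sub_rootMultiplicity_mul_eval {R : Type*} [CommRing R] [IsDomain R]
    {p q s r : R[X]} (hp : p ≠ 0) (hq : q ≠ 0) (z : R)
    (h : wronskian q p * ((X - C z) * s) = r * (p * q)) :
    ((p.rootMultiplicity z : R) - q.rootMultiplicity z) * s.eval z = r.eval z := by
  obtain ⟨p₁, hpp₁, hp₁⟩ := exists_eq_pow_rootMultiplicity_mul_and_not_dvd p hp z
  obtain ⟨q₁, hqq₁, hq₁⟩ := exists_eq_pow_rootMultiplicity_mul_and_not_dvd q hq z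
  rw [dvd_iff_isRoot, IsRoot.def] at hp₁ hq₁
  generalize p.rootMultiplicity z = m at *
  generalize q.rootMultiplicity z = n at *
  subst hpp₁ hqq₁
  have hcancel : (C (m - n : R) * (p₁ * q₁) + (X - C z) * wronskian q₁ p₁) * s =
      r * (p₁ * q₁) := by
    refine mul_left_cancel₀ (pow_ne_zero (m + n) (X_sub_C_ne_zero z)) ?_
    linear_combination h - s * X_sub_C_mul_wronskian_pow_mul z m n p₁ q₁
  have heval := congrArg (eval z) hcancel
  simp only [eval_mul, eval_add, eval_sub, eval_C, eval_X, sub_self, zero_mul, add_zero] at heval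
  refine mul_left_cancel₀ (mul_ne_zero hp₁ hq₁) ?_
  linear_combination heval

theorem exists_int_mul_eq_I_mul_of_wronskian_mul_eq {A B Q q : ℂ[X]} {s κ z : ℂ} (hs : s ≠ 0)
    (hQ : Q ≠ 0) (hz : q.IsRoot z) (hAB : A ^ 2 + B ^ 2 = C s * Q ^ 2)
    (hW : wronskian A B * q = C κ * (A ^ 2 + B ^ 2)) :
    ∃ n : ℤ, n * (derivative q).eval z = Complex.I * κ := by
  obtain ⟨q₁, rfl⟩ := dvd_iff_isRoot.2 hz
  have hI : (C Complex.I : ℂ[X]) ^ 2 = -1 := by rw [← C_pow, Complex.I_sq, C_neg, C_1]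
  have hfactor : (A + C Complex.I * B) * (A - C Complex.I * B) = C s * Q ^ 2 := by
    linear_combination hAB - B ^ 2 * hI
  have hne : C s * Q ^ 2 ≠ 0 := mul_ne_zero (C_ne_zero.2 hs) (pow_ne_zero 2 hQ)
  obtain ⟨hP, hR⟩ := mul_ne_zero_iff.1 (hfactor ▸ hne)
  have hresidue := rootMultiplicity_sub_rootMultiplicity_mul_eval (s := q₁)
    (r := C (2 * Complex.I * κ)) hP hR z (by
      simp only [wronskian, derivative_add, derivative_sub, derivative_C_mul, C_mul, map_ofNat]
        at hW ⊢
      linear_combination (2 * C Complex.I) * hW + (2 * C Complex.I * C κ * B ^ 2) * hI)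
  have hmult := congrArg (rootMultiplicity z) hfactor
  rw [rootMultiplicity_mul (hfactor ▸ hne), rootMultiplicity_mul hne, rootMultiplicity_C, zero_add,
    pow_two, rootMultiplicity_mul (mul_ne_zero hQ hQ)] at hmult
  set m := (A + C Complex.I * B).rootMultiplicity z
  set n := (A - C Complex.I * B).rootMultiplicity z
  set k := Q.rootMultiplicity z
  have hmult' : (m : ℂ) + n = k + k := by exact_mod_cast hmult
  refine ⟨m - k, ?_⟩
  simp only [derivative_mul, derivative_sub, derivative_X, derivative_C, eval_add, eval_mul,
    eval_sub, eval_X, eval_C, sub_self, sub_zero, zero_mul, add_zero, one_mul] at hresidue ⊢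
  push_cast
  linear_combination hresidue / 2 + eval z q₁ / 2 * hmult'

theorem exists_int_eq_of_wronskian_mul_sq_eq {A B Q q : ℂ[X]} {s c z : ℂ} (hs : s ≠ 0)
    (hQ : Q ≠ 0) (hz : q.IsRoot z) (hz' : (derivative q).eval z ≠ 0)
    (hAB : A ^ 2 + B ^ 2 = C s * Q ^ 2)
    (hW : (wronskian A B * q) ^ 2 =
      -(C (c * (derivative q).eval z) * (A ^ 2 + B ^ 2)) ^ 2) : ∃ n : ℤ, c = n := by
  set d := (derivative q).eval z
  have hI : (C Complex.I : ℂ[X]) ^ 2 = -1 := by rw [← C_pow, Complex.I_sq, C_neg, C_1]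
  have hW' : (wronskian A B * q) ^ 2 = (C (Complex.I * (c * d)) * (A ^ 2 + B ^ 2)) ^ 2 := by
    rw [C_mul (a := Complex.I), hW]
    linear_combination (-(C (c * d) * (A ^ 2 + B ^ 2)) ^ 2) * hI
  rcases sq_eq_sq_iff_eq_or_eq_neg.1 hW' with h | h
  · obtain ⟨n, hn⟩ := exists_int_mul_eq_I_mul_of_wronskian_mul_eq hs hQ hz hAB h
    refine ⟨-n, mul_right_cancel₀ hz' ?_⟩
    push_cast
    linear_combination hn + c * d * Complex.I_sq
  · obtain ⟨n, hn⟩ := exists_int_mul_eq_I_mul_of_wronskian_mul_eq hs hQ hz hAB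
      (h.trans (by rw [← neg_mul, ← C_neg]))
    refine ⟨n, mul_right_cancel₀ hz' ?_⟩
    linear_combination -hn + c * d * Complex.I_sq

theorem iterate_derivative_three_sq {R : Type*} [CommRing R] {p : R[X]} (hp : p.natDegree ≤ 2) :
    derivative^[3] (p ^ 2) = 3 * derivative (derivative p ^ 2) := by
  have hp3 : derivative (derivative (derivative p)) = 0 :=
    iterate_derivative_eq_zero (x := 3) (by lia)
  simp only [Function.iterate_succ, Function.iterate_zero, Function.comp_apply, id, sq,
    derivative_mul, derivative_add, hp3]
  ring

theorem exists_sum_derivative_sq_eq {R ι : Type*} [CommRing R] [IsDomain R] [CharZero R]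
    [Fintype ι] {p : ι → R[X]} {q : R[X]} (hp : ∀ i, (p i).natDegree ≤ 2) (hq : q.natDegree ≤ 2)
    (h : ∑ i, p i ^ 2 = q ^ 2) : ∃ ν : R, ∑ i, derivative (p i) ^ 2 = derivative q ^ 2 + C ν := by
  have hthird := congrArg derivative^[3] h
  rw [iterate_derivative_sum, iterate_derivative_three_sq hq,
    Finset.sum_congr rfl fun i _ => iterate_derivative_three_sq (hp i), ← Finset.mul_sum,
    ← derivative_sum] at hthird
  have hconst : derivative (∑ i, derivative (p i) ^ 2 - derivative q ^ 2) = 0 := by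
    rw [derivative_sub, sub_eq_zero]
    exact mul_left_cancel₀ (OfNat.ofNat_ne_zero 3) hthird
  exact ⟨_, sub_eq_iff_eq_add'.1 (eq_C_of_derivative_eq_zero hconst)⟩

theorem dotProduct_self_eq_zero_of_isotropic {K : Type*} [Field K] {u x y : Fin 3 → K}
    (hu : u ⬝ᵥ u ≠ 0) (hux : u ⬝ᵥ x = 0) (huy : u ⬝ᵥ y = 0) (hx : x ≠ 0) (hxx : x ⬝ᵥ x = 0)
    (hxy : x ⬝ᵥ y = 0) : y ⬝ᵥ y = 0 := by
  have hu_cross : u ⨯₃ (x ⨯₃ y) = 0 := by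
    rw [cross_cross_eq_smul_sub_smul', huy, dotProduct_comm x, hux, zero_smul, zero_smul, sub_zero]
  have hparallel : (u ⬝ᵥ u) • x ⨯₃ y = (u ⬝ᵥ x ⨯₃ y) • u := by
    have h := cross_cross_eq_smul_sub_smul' u u (x ⨯₃ y)
    rw [hu_cross, map_zero] at h
    exact (sub_eq_zero.1 h.symm).symm
  have hisotropic : x ⨯₃ y ⬝ᵥ x ⨯₃ y = 0 := by
    rw [cross_dot_cross, hxx, hxy, zero_mul, zero_mul, sub_zero]
  have hcross : x ⨯₃ y = 0 := by
    have h := congrArg (· ⬝ᵥ x ⨯₃ y) hparallel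
    simp only [smul_dotProduct, hisotropic, smul_eq_mul, mul_zero, zero_eq_mul, or_self] at h
    rw [h, zero_smul] at hparallel
    exact (smul_eq_zero.1 hparallel).resolve_left hu
  have h := cross_cross_eq_smul_sub_smul' y x y
  rw [hcross, map_zero, hxy, zero_smul, sub_zero] at h
  exact (smul_eq_zero.1 h.symm).resolve_right hx

/-- `p / q` is a rational parametrization, of degree at most two, of the section of the unit sphere
by the plane `u ⬝ x = c`, `u` a unit vector. The equations are cleared of denominators, so that they
can be evaluated at the complex roots of `q`. -/
structure IsSphericalConic {K : Type*} [Field K] (p : Fin 3 → K[X]) (q : K[X]) (u : Fin 3 → K)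
    (c : K) : Prop where
  natDegree_le : ∀ i, (p i).natDegree ≤ 2
  natDegree_denom_le : q.natDegree ≤ 2
  sum_sq : ∑ i, p i ^ 2 = q ^ 2
  sum_normal_sq : ∑ i, u i ^ 2 = 1
  sum_normal_mul : ∑ i, C (u i) * p i = C c * q

namespace IsSphericalConic

variable {K : Type*} [Field K] {p : Fin 3 → K[X]} {q : K[X]} {u : Fin 3 → K} {c : K}

theorem map {L : Type*} [Field L] (φ : K →+* L) (h : IsSphericalConic p q u c) :
    IsSphericalConic (fun i => (p i).map φ) (q.map φ) (fun i => φ (u i)) (φ c) where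
  natDegree_le i := natDegree_map_le.trans (h.natDegree_le i)
  natDegree_denom_le := natDegree_map_le.trans h.natDegree_denom_le
  sum_sq := by simpa [Polynomial.map_sum] using congrArg (Polynomial.map φ) h.sum_sq
  sum_normal_sq := by simpa using congrArg φ h.sum_normal_sq
  sum_normal_mul := by
    simpa [Polynomial.map_sum] using congrArg (Polynomial.map φ) h.sum_normal_mul

theorem sum_derivative_sq_eq [CharZero K] (h : IsSphericalConic p q u c) {z : K}
    (hz : q.IsRoot z) {i : Fin 3} (hi : ¬ (p i).IsRoot z) :
    ∑ i, derivative (p i) ^ 2 =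
      derivative q ^ 2 - C ((1 - c ^ 2) * (derivative q).eval z ^ 2) := by
  obtain ⟨ν, hν⟩ := exists_sum_derivative_sq_eq h.natDegree_le h.natDegree_denom_le h.sum_sq
  set d := (derivative q).eval z
  have hq : q.eval z = 0 := hz
  have hu : ∑ i, u i * u i = 1 := by simpa only [sq] using h.sum_normal_sq
  have hup : ∑ i, u i * (p i).eval z = 0 := by
    simpa [eval_finsetSum, hq] using congrArg (eval z) h.sum_normal_mul
  have hup' : ∑ i, u i * (derivative (p i)).eval z = c * d := by
    simpa [eval_finsetSum] using congrArg (fun r => (derivative r).eval z) h.sum_normal_mul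
  have hpp : ∑ i, (p i).eval z * (p i).eval z = 0 := by
    simpa [eval_finsetSum, hq, sq] using congrArg (eval z) h.sum_sq
  have hpp' : ∑ i, (p i).eval z * (derivative (p i)).eval z = 0 := by
    have := congrArg (fun r => (derivative r).eval z) h.sum_sq
    simpa [eval_finsetSum, derivative_pow, hq, mul_assoc, ← Finset.mul_sum] using this
  have hderiv_sq : ∑ i, (derivative (p i)).eval z ^ 2 = d ^ 2 + ν := by
    simpa [eval_finsetSum] using congrArg (eval z) hν
  simp only [Fin.sum_univ_three] at hu hup hup' hpp hpp' hderiv_sq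
  have hisotropic := dotProduct_self_eq_zero_of_isotropic (u := u) (x := fun i => (p i).eval z)
    (y := fun i => (derivative (p i)).eval z - c * d * u i)
    (by simp [vec3_dotProduct, hu]) (by rw [vec3_dotProduct, hup])
    (by rw [vec3_dotProduct]; linear_combination hup' - c * d * hu)
    (fun h0 => hi (congrFun h0 i)) (by rw [vec3_dotProduct, hpp])
    (by rw [vec3_dotProduct]; linear_combination hpp' - c * d * hup)
  rw [vec3_dotProduct] at hisotropic
  have hν' : ν = -((1 - c ^ 2) * d ^ 2) := by
    linear_combination hisotropic - hderiv_sq + 2 * c * d * hup' - c ^ 2 * d ^ 2 * hu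
  rw [hν, hν', C_neg, ← sub_eq_add_neg]

theorem exists_int_eq {p : Fin 3 → ℂ[X]} {q A B Q : ℂ[X]} {u : Fin 3 → ℂ} {c z : ℂ}
    (h : IsSphericalConic p q u c) (hc : 1 - c ^ 2 ≠ 0) (hz : q.IsRoot z)
    (hz' : (derivative q).eval z ≠ 0) {i : Fin 3} (hi : ¬ (p i).IsRoot z) (hQ : Q ≠ 0)
    (hAB : A ^ 2 + B ^ 2 = C (1 - c ^ 2) * Q ^ 2)
    (hW : (wronskian A B * q) ^ 2 =
      C (c ^ 2 * (1 - c ^ 2)) * (∑ i, derivative (p i) ^ 2 - derivative q ^ 2) * Q ^ 4) :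
    ∃ n : ℤ, c = n := by
  refine exists_int_eq_of_wronskian_mul_sq_eq hc hQ hz hz' hAB ?_
  rw [hW, hAB, h.sum_derivative_sq_eq hz hi]
  simp only [C_mul, C_pow]
  ring

theorem sq_lt_one {p : Fin 3 → ℝ[X]} {q : ℝ[X]} {u : Fin 3 → ℝ} {c : ℝ}
    (h : IsSphericalConic p q u c) {i : Fin 3} (hi : ¬ q ∣ p i) : c ^ 2 < 1 := by
  by_contra! hc
  have hcenter : ∑ i, (p i - C (c * u i) * q) ^ 2 = C (1 - c ^ 2) * q ^ 2 := by
    have hu : ∑ i, C (u i) ^ 2 = (1 : ℝ[X]) := by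
      simpa using congrArg (C : ℝ →+* ℝ[X]) h.sum_normal_sq
    have hsq := h.sum_sq
    have hmul := h.sum_normal_mul
    simp only [Fin.sum_univ_three, C_mul, C_sub, C_pow, C_1] at hu hsq hmul ⊢
    linear_combination hsq - 2 * C c * q * hmul + C c ^ 2 * q ^ 2 * hu
  refine hi ⟨C (c * u i), Polynomial.funext fun t => ?_⟩
  have hle : ∑ i, (p i - C (c * u i) * q).eval t ^ 2 ≤ 0 := by
    have heval := congrArg (eval t) hcenter
    simp only [eval_finsetSum, eval_pow, eval_mul (p := C (1 - c ^ 2)), eval_C] at heval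
    rw [heval]
    exact mul_nonpos_of_nonpos_of_nonneg (sub_nonpos.2 hc) (sq_nonneg _)
  have hzero : (p i - C (c * u i) * q).eval t = 0 := by
    rw [← sq_eq_zero_iff]
    refine le_antisymm ?_ (sq_nonneg _)
    exact (Finset.single_le_sum (f := fun i => (p i - C (c * u i) * q).eval t ^ 2)
      (fun j _ => sq_nonneg _) (Finset.mem_univ i)).trans hle
  rw [mul_comm]
  rwa [eval_sub, sub_eq_zero] at hzero

theorem eq_zero_of_irreducible {p : Fin 3 → ℝ[X]} {q A B Q : ℝ[X]} {u : Fin 3 → ℝ} {c : ℝ}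
    (h : IsSphericalConic p q u c) (hq : Irreducible q) {i : Fin 3} (hi : ¬ q ∣ p i)
    (hQ : Q ≠ 0) (hAB : A ^ 2 + B ^ 2 = C (1 - c ^ 2) * Q ^ 2)
    (hW : (wronskian A B * q) ^ 2 =
      C (c ^ 2 * (1 - c ^ 2)) * (∑ i, derivative (p i) ^ 2 - derivative q ^ 2) * Q ^ 4) :
    c = 0 := by
  set φ := algebraMap ℝ ℂ
  obtain ⟨z, hz⟩ := Complex.exists_root (f := q.map φ) (by
    rw [degree_map]
    exact degree_pos_of_irreducible hq)
  have hz' : (derivative (q.map φ)).eval z ≠ 0 := by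
    simpa using hq.separable.map.aeval_derivative_ne_zero hz
  have hi' : ¬ ((p i).map φ).IsRoot z := by
    have hcop := ((hq.coprime_iff_not_dvd.2 hi).map (mapRingHom φ)).map (evalRingHom z)
    simp only [coe_mapRingHom, coe_evalRingHom, hz.eq_zero, isCoprime_zero_left] at hcop
    exact hcop.ne_zero
  have hmap : ∃ n : ℤ, (c : ℂ) = n := by
    refine (h.map φ).exists_int_eq (A := A.map φ) (B := B.map φ) (Q := Q.map φ) ?_ hz hz' hi'
      (Polynomial.map_ne_zero hQ) ?_ ?_
    · change 1 - (c : ℂ) ^ 2 ≠ 0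
      exact_mod_cast (sub_pos.2 (h.sq_lt_one hi)).ne'
    · simpa using congrArg (Polynomial.map φ) hAB
    · simpa [wronskian, Polynomial.map_sum] using congrArg (Polynomial.map φ) hW
  obtain ⟨n, rfl⟩ : ∃ n : ℤ, c = n := by exact_mod_cast hmap
  have hn : (n ^ 2 : ℤ) < 1 := by exact_mod_cast h.sq_lt_one hi
  rw [Int.abs_lt_one_iff.1 ((sq_lt_one_iff_abs_lt_one n).1 hn), Int.cast_zero]

end IsSphericalConic

section MovingFrame

variable {E : Type*} [NormedAddCommGroup E] [InnerProductSpace ℝ E]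

theorem inner_add_inner_eq_zero_of_eventually_inner_eq {v w : ℝ → E} {v' w' : E} {c t : ℝ}
    (hv : HasDerivAt v v' t) (hw : HasDerivAt w w' t) (h : ∀ᶠ s in 𝓝 t, inner ℝ (v s) (w s) = c) :
    inner ℝ (v t) w' + inner ℝ v' (w t) = 0 :=
  (hv.inner ℝ hw).unique ((hasDerivAt_const t c).congr_of_eventuallyEq h)

theorem inner_deriv_self_eq_zero_of_eventually_norm_eq {v : ℝ → E} {v' : E} {a t : ℝ}
    (hv : HasDerivAt v v' t) (h : ∀ᶠ s in 𝓝 t, ‖v s‖ = a) : inner ℝ v' (v t) = 0 := by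
  have hsum := inner_add_inner_eq_zero_of_eventually_inner_eq hv hv
    (h.mono fun s hs => by rw [real_inner_self_eq_norm_sq, hs])
  rw [real_inner_comm v'] at hsum
  exact self_eq_neg.1 (eq_neg_of_add_eq_zero_left hsum)

theorem inner_eq_sum_inner_mul_inner {ι : Type*} [Fintype ι] [Nonempty ι] {e : ι → E}
    (he : Orthonormal ℝ e) (hcard : Fintype.card ι = finrank ℝ E) (x y : E) :
    inner ℝ x y = ∑ i, inner ℝ x (e i) * inner ℝ (e i) y := by
  have hspan := (he.linearIndependent.span_eq_top_of_card_eq_finrank hcard).ge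
  simpa using ((OrthonormalBasis.mk he hspan).sum_inner_mul_inner x y).symm

variable {f : Fin 3 → ℝ → E} {f' : Fin 3 → E} {u : E} {c t : ℝ}

theorem inner_deriv_eq_of_rotation_minimizing (hE : finrank ℝ E = 3)
    (hf : ∀ k, HasDerivAt (f k) (f' k) t) (hon : ∀ᶠ s in 𝓝 t, Orthonormal ℝ fun k => f k s)
    (hrm : inner ℝ (f' 1) (f 2 t) = 0) {k : Fin 3} (hk : k ≠ 0) (u : E) :
    inner ℝ (f' k) u = -inner ℝ (f' 0) (f k t) * inner ℝ (f 0 t) u := by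
  have hskew : ∀ i j, inner ℝ (f' i) (f j t) = -inner ℝ (f' j) (f i t) := by
    intro i j
    rw [real_inner_comm (f i t), eq_neg_iff_add_eq_zero, add_comm]
    exact inner_add_inner_eq_zero_of_eventually_inner_eq (hf i) (hf j)
      (hon.mono fun s hs => orthonormal_iff_ite.1 hs i j)
  have hself : ∀ i, inner ℝ (f' i) (f i t) = 0 := fun i => self_eq_neg.1 (hskew i i)
  rw [inner_eq_sum_inner_mul_inner hon.self_of_nhds (by simp [hE]), Fin.sum_univ_three, hskew k 0]
  obtain rfl | rfl : k = 1 ∨ k = 2 := by lia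
  · simp [hself, hrm]
  · simp [hself, hskew 2 1, hrm]

theorem inner_sq_add_inner_sq_of_orthonormal {e : Fin 3 → E} (hE : finrank ℝ E = 3)
    (he : Orthonormal ℝ e) (u : E) :
    inner ℝ (e 1) u ^ 2 + inner ℝ (e 2) u ^ 2 = ‖u‖ ^ 2 - inner ℝ (e 0) u ^ 2 := by
  rw [← real_inner_self_eq_norm_sq, inner_eq_sum_inner_mul_inner he (by simp [hE]) u u]
  simp only [Fin.sum_univ_three, real_inner_comm _ u]
  ring

theorem inner_wronskian_sq_eq_of_rotation_minimizing (hE : finrank ℝ E = 3)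
    (hf : ∀ k, HasDerivAt (f k) (f' k) t) (hon : ∀ᶠ s in 𝓝 t, Orthonormal ℝ fun k => f k s)
    (hrm : inner ℝ (f' 1) (f 2 t) = 0) (hu : ∀ᶠ s in 𝓝 t, inner ℝ (f 0 s) u = c) :
    (inner ℝ (f 1 t) u * inner ℝ (f' 2) u - inner ℝ (f' 1) u * inner ℝ (f 2 t) u) ^ 2 =
      c ^ 2 * (‖u‖ ^ 2 - c ^ 2) * ‖f' 0‖ ^ 2 := by
  have hon_t := hon.self_of_nhds
  have hparseval := inner_eq_sum_inner_mul_inner hon_t (by simp [hE]) (f' 0)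
  have htangent : inner ℝ (f' 0) (f 0 t) = 0 :=
    inner_deriv_self_eq_zero_of_eventually_norm_eq (hf 0) (hon.mono fun s hs => hs.1 0)
  have horthogonal : inner ℝ (f' 0) (f 1 t) * inner ℝ (f 1 t) u +
      inner ℝ (f' 0) (f 2 t) * inner ℝ (f 2 t) u = 0 := by
    have h := inner_add_inner_eq_zero_of_eventually_inner_eq (hf 0) (hasDerivAt_const t u) hu
    simpa [hparseval u, Fin.sum_univ_three, htangent] using h
  have hspeed : inner ℝ (f' 0) (f 1 t) ^ 2 + inner ℝ (f' 0) (f 2 t) ^ 2 = ‖f' 0‖ ^ 2 := by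
    rw [← real_inner_self_eq_norm_sq, hparseval (f' 0)]
    simp only [Fin.sum_univ_three, real_inner_comm (f' 0) (f _ t), htangent]
    ring
  rw [inner_deriv_eq_of_rotation_minimizing hE hf hon hrm one_ne_zero,
    inner_deriv_eq_of_rotation_minimizing hE hf hon hrm (k := 2) (by decide),
    hu.self_of_nhds, ← hspeed]
  have hnormal := inner_sq_add_inner_sq_of_orthonormal hE hon_t u
  rw [hu.self_of_nhds] at hnormal
  rw [← hnormal]
  generalize inner ℝ (f' 0) (f 1 t) = y₁ at *
  generalize inner ℝ (f' 0) (f 2 t) = y₂ at *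
  linear_combination (-c ^ 2 * (y₁ * inner ℝ (f 1 t) u + y₂ * inner ℝ (f 2 t) u)) * horthogonal

end MovingFrame

section RationalDerivative

variable {t : ℝ}

theorem eval_derivative_eq_of_eventually_eval_eq_mul {p q : ℝ[X]} {g : ℝ → ℝ} {g' : ℝ}
    (hg : HasDerivAt g g' t) (h : ∀ᶠ s in 𝓝 t, p.eval s = q.eval s * g s) :
    (derivative p).eval t = (derivative q).eval t * g t + q.eval t * g' :=
  (p.hasDerivAt t).unique (((q.hasDerivAt t).mul hg).congr_of_eventuallyEq h)

theorem eval_wronskian_eq_of_eventually_eval_eq_mul {A B Q : ℝ[X]} {g h : ℝ → ℝ} {g' h' : ℝ}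
    (hg : HasDerivAt g g' t) (hh : HasDerivAt h h' t)
    (hA : ∀ᶠ s in 𝓝 t, A.eval s = Q.eval s * g s) (hB : ∀ᶠ s in 𝓝 t, B.eval s = Q.eval s * h s) :
    (wronskian A B).eval t = Q.eval t ^ 2 * (g t * h' - g' * h t) := by
  rw [wronskian, eval_sub, eval_mul, eval_mul, eval_derivative_eq_of_eventually_eval_eq_mul hg hA,
    eval_derivative_eq_of_eventually_eval_eq_mul hh hB, hA.self_of_nhds, hB.self_of_nhds]
  ring

theorem sum_eval_derivative_sq_eq_of_norm_eq_one {ι : Type*} [Fintype ι] {p : ι → ℝ[X]} {q : ℝ[X]}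
    {v : ℝ → EuclideanSpace ℝ ι} {v' : EuclideanSpace ℝ ι} (hv : HasDerivAt v v' t)
    (hnorm : ∀ᶠ s in 𝓝 t, ‖v s‖ = 1)
    (h : ∀ᶠ s in 𝓝 t, ∀ i, (p i).eval s = q.eval s * v s i) :
    ∑ i, (derivative (p i)).eval t ^ 2 = (derivative q).eval t ^ 2 + q.eval t ^ 2 * ‖v'‖ ^ 2 := by
  have hderiv : WithLp.toLp 2 (fun i => (derivative (p i)).eval t) =
      (derivative q).eval t • v t + q.eval t • v' := by
    ext i
    simpa using eval_derivative_eq_of_eventually_eval_eq_mul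
      ((EuclideanSpace.proj i).hasFDerivAt.comp_hasDerivAt t hv) (h.mono fun s hs => hs i)
  have horth : inner ℝ (v t) v' = 0 := by
    rw [real_inner_comm, inner_deriv_self_eq_zero_of_eventually_norm_eq hv hnorm]
  have hsq := EuclideanSpace.real_norm_sq_eq (WithLp.toLp 2 fun i => (derivative (p i)).eval t)
  rw [← hsq, hderiv, norm_add_sq_real, real_inner_smul_left, real_inner_smul_right, horth,
    norm_smul, norm_smul, hnorm.self_of_nhds, mul_pow, mul_pow, Real.norm_eq_abs, Real.norm_eq_abs,
    sq_abs, sq_abs]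
  ring

end RationalDerivative

namespace IsRationalOn

variable {I : Set ℝ} {f g : ℝ → ℝ}

theorem exists_common_denominator (hf : IsRationalOn I f) (hg : IsRationalOn I g) :
    ∃ A B Q : ℝ[X], ∀ t ∈ I, Q.eval t ≠ 0 ∧ f t = A.eval t / Q.eval t ∧
      g t = B.eval t / Q.eval t := by
  obtain ⟨p, q, hpq⟩ := hf
  obtain ⟨p', q', hpq'⟩ := hg
  refine ⟨p * q', p' * q, q * q', fun t ht => ?_⟩
  obtain ⟨hq, hf⟩ := hpq t ht
  obtain ⟨hq', hg⟩ := hpq' t ht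
  simp only [eval_mul]
  refine ⟨mul_ne_zero hq hq', ?_, ?_⟩
  · rw [hf, mul_div_mul_right _ _ hq']
  · rw [hg, mul_comm (eval t q), mul_div_mul_right _ _ hq]

theorem add (hf : IsRationalOn I f) (hg : IsRationalOn I g) :
    IsRationalOn I fun t => f t + g t := by
  obtain ⟨A, B, Q, h⟩ := hf.exists_common_denominator hg
  refine ⟨A + B, Q, fun t ht => ⟨(h t ht).1, ?_⟩⟩
  simp only [(h t ht).2, eval_add, add_div]

theorem sub (hf : IsRationalOn I f) (hg : IsRationalOn I g) :
    IsRationalOn I fun t => f t - g t := by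
  obtain ⟨A, B, Q, h⟩ := hf.exists_common_denominator hg
  refine ⟨A - B, Q, fun t ht => ⟨(h t ht).1, ?_⟩⟩
  simp only [(h t ht).2, eval_sub, sub_div]

theorem const_mul (hf : IsRationalOn I f) (a : ℝ) : IsRationalOn I fun t => a * f t := by
  obtain ⟨p, q, h⟩ := hf
  refine ⟨C a * p, q, fun t ht => ⟨(h t ht).1, ?_⟩⟩
  simp only [(h t ht).2, eval_mul, eval_C, mul_div_assoc]

theorem differentiableAt (hf : IsRationalOn I f) {t : ℝ} (ht : I ∈ 𝓝 t) :
    DifferentiableAt ℝ f t := by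
  obtain ⟨p, q, h⟩ := hf
  exact (p.differentiableAt.div q.differentiableAt (h t (mem_of_mem_nhds ht)).1)
    |>.congr_of_eventuallyEq (eventually_of_mem ht fun s hs => (h s hs).2)

theorem eq_zero_or_eq_zero_of_mul_eq_zero (hI : I.Infinite) (hf : IsRationalOn I f)
    (hg : IsRationalOn I g) (h : ∀ t ∈ I, f t * g t = 0) :
    (∀ t ∈ I, f t = 0) ∨ ∀ t ∈ I, g t = 0 := by
  obtain ⟨A, B, Q, hABQ⟩ := hf.exists_common_denominator hg
  have hAB : A * B = 0 := by
    refine eq_of_infinite_eval_eq _ _ (hI.mono fun t ht => ?_)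
    obtain ⟨hQ, hf, hg⟩ := hABQ t ht
    simpa [hf, hg, hQ] using h t ht
  refine (mul_eq_zero.1 hAB).imp (fun hA t ht => ?_) fun hB t ht => ?_
  · rw [(hABQ t ht).2.1, hA, eval_zero, zero_div]
  · rw [(hABQ t ht).2.2, hB, eval_zero, zero_div]

end IsRationalOn

namespace IsRationalVecOn

variable {I : Set ℝ} {v : ℝ → Space3}

theorem inner_const (hv : IsRationalVecOn I v) (u : Space3) :
    IsRationalOn I fun t => inner ℝ (v t) u := by
  simp only [PiLp.inner_apply, Fin.sum_univ_three]
  exact (((hv 0).const_mul (u 0)).add ((hv 1).const_mul (u 1))).add ((hv 2).const_mul (u 2))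

theorem differentiableAt (hv : IsRationalVecOn I v) {t : ℝ} (ht : I ∈ 𝓝 t) :
    DifferentiableAt ℝ v t :=
  differentiableAt_euclidean.2 fun i => (hv i).differentiableAt ht

end IsRationalVecOn

theorem IsUnitTangentOn.eqOn_or_eqOn_neg {I : Set ℝ} {r T S : ℝ → Space3} (hI : I.Infinite)
    (hT : IsUnitTangentOn I r T) (hS : IsUnitTangentOn I r S) (hTrat : IsRationalVecOn I T)
    (hSrat : IsRationalVecOn I S) : Set.EqOn S T I ∨ Set.EqOn S (-T) I := by
  obtain ⟨hTnorm, σ, hσ, ⟨t₀, ht₀, hσ₀⟩, hrT⟩ := hT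
  obtain ⟨hSnorm, ρ, hρ, -, hrS⟩ := hS
  have hvel : ∀ t ∈ I, ρ t • S t = σ t • T t := fun t ht => (hrS t ht).unique (hrT t ht)
  have hspeed : ∀ t ∈ I, (ρ t - σ t) * (ρ t + σ t) = 0 := by
    intro t ht
    have habs : |ρ t| = |σ t| := by
      simpa [norm_smul, hTnorm t ht, hSnorm t ht] using congrArg norm (hvel t ht)
    linear_combination (sq_eq_sq_iff_abs_eq_abs _ _).2 habs
  have hcancel : ∀ {g : ℝ → ℝ}, IsRationalOn I g → (∀ t ∈ I, σ t * g t = 0) → ∀ t ∈ I, g t = 0 :=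
    fun hg h => (hσ.eq_zero_or_eq_zero_of_mul_eq_zero hI hg h).resolve_left
      fun hzero => hσ₀ (hzero t₀ ht₀)
  have hvel_apply : ∀ t ∈ I, ∀ i, ρ t * S t i = σ t * T t i := fun t ht i =>
    congrArg (fun v : Space3 => v i) (hvel t ht)
  refine ((hρ.sub hσ).eq_zero_or_eq_zero_of_mul_eq_zero hI (hρ.add hσ) hspeed).imp
    (fun h t ht => PiLp.ext fun i => ?_) fun h t ht => PiLp.ext fun i => ?_
  · refine sub_eq_zero.1 (hcancel ((hSrat i).sub (hTrat i)) (fun s hs => ?_) t ht)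
    linear_combination hvel_apply s hs i - S s i * h s hs
  · refine eq_neg_of_add_eq_zero_left (hcancel ((hSrat i).add (hTrat i)) (fun s hs => ?_) t ht)
    linear_combination -hvel_apply s hs i + S s i * h s hs

namespace HasRationalDegreeOn

variable {I : Set ℝ} {v w : ℝ → Space3} {d : ℕ}

theorem isRationalVecOn (h : HasRationalDegreeOn I v d) : IsRationalVecOn I v := by
  obtain ⟨p, q, -, -, hpq⟩ := h
  exact fun i => ⟨p i, q, fun t ht => ⟨(hpq t ht).1, (hpq t ht).2 i⟩⟩

theorem congr (h : HasRationalDegreeOn I v d) (hwv : Set.EqOn w v I) :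
    HasRationalDegreeOn I w d := by
  obtain ⟨p, q, hcop, hdeg, hpq⟩ := h
  refine ⟨p, q, hcop, hdeg, fun t ht => ?_⟩
  rw [hwv ht]
  exact hpq t ht

theorem neg (h : HasRationalDegreeOn I v d) : HasRationalDegreeOn I (-v) d := by
  obtain ⟨p, q, hcop, hdeg, hpq⟩ := h
  refine ⟨-p, q, by simpa using hcop, by simpa using hdeg, fun t ht => ⟨(hpq t ht).1, fun i => ?_⟩⟩
  simp [(hpq t ht).2 i, neg_div]

end HasRationalDegreeOn

theorem sum_sq_eq_sq_of_norm_eq_one {ι : Type*} [Fintype ι] {I : Set ℝ} (hI : I.Infinite)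
    {v : ℝ → EuclideanSpace ℝ ι} {p : ι → ℝ[X]} {q : ℝ[X]} (hv : ∀ t ∈ I, ‖v t‖ = 1)
    (hpq : ∀ t ∈ I, ∀ i, (p i).eval t = q.eval t * v t i) : ∑ i, p i ^ 2 = q ^ 2 := by
  refine eq_of_infinite_eval_eq _ _ (hI.mono fun t ht => ?_)
  have hnorm := EuclideanSpace.real_norm_sq_eq (v t)
  rw [hv t ht, one_pow] at hnorm
  simp only [Set.mem_ofPred_eq, eval_finsetSum, eval_pow, hpq t ht, mul_pow, ← Finset.mul_sum,
    ← hnorm, mul_one]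

theorem irreducible_of_sum_sq_eq_sq {ι : Type*} [Fintype ι] {p : ι → ℝ[X]} {q : ℝ[X]}
    (hq : q.natDegree = 2) (h : ∑ i, p i ^ 2 = q ^ 2)
    (hcop : ∀ g, g ∣ q → (∀ i, g ∣ p i) → IsUnit g) : Irreducible q := by
  refine irreducible_of_degree_le_three_of_not_isRoot (by simp [hq]) fun x hx => ?_
  refine not_isUnit_X_sub_C x (hcop _ (dvd_iff_isRoot.2 hx) fun i => dvd_iff_isRoot.2 ?_)
  have hsum : ∑ j, (p j).eval x ^ 2 = 0 := by
    simpa [eval_finsetSum, hx.eq_zero] using congrArg (eval x) h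
  rw [Finset.sum_eq_zero_iff_of_nonneg fun j _ => sq_nonneg _] at hsum
  exact sq_eq_zero_iff.1 (hsum i (Finset.mem_univ i))

theorem HasRationalDegreeOn.exists_isSphericalConic {I : Set ℝ} (hI : I.Infinite)
    {v : ℝ → Space3} (hv : ∀ t ∈ I, ‖v t‖ = 1) (hdeg : HasRationalDegreeOn I v 2) {u : Space3}
    (hu : ‖u‖ = 1) {c : ℝ} (hc : ∀ t ∈ I, inner ℝ (v t) u = c) :
    ∃ p q, IsSphericalConic p q (fun i => u i) c ∧ Irreducible q ∧ (∃ i, ¬ q ∣ p i) ∧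
      ∀ t ∈ I, ∀ i, (p i).eval t = q.eval t * v t i := by
  obtain ⟨p, q, hcop, hd, hv_eq⟩ := hdeg
  have hpq : ∀ t ∈ I, ∀ i, (p i).eval t = q.eval t * v t i := fun t ht i => by
    rw [(hv_eq t ht).2 i, mul_div_cancel₀ _ (hv_eq t ht).1]
  have hsum := sum_sq_eq_sq_of_norm_eq_one hI hv hpq
  have hle := natDegree_le_of_sum_sq_eq_sq hsum
  have hq : q.natDegree = 2 := by rwa [max_eq_left (Finset.sup_le fun i _ => hle i)] at hd
  have hirr := irreducible_of_sum_sq_eq_sq hq hsum hcop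
  refine ⟨p, q, ⟨fun i => hq ▸ hle i, hq.le, hsum, ?_, ?_⟩, hirr, ?_, hpq⟩
  · rw [← EuclideanSpace.real_norm_sq_eq, hu, one_pow]
  · refine eq_of_infinite_eval_eq _ _ (hI.mono fun t ht => ?_)
    simp only [Set.mem_ofPred_eq, eval_add, eval_mul, eval_C, hpq t ht, ← hc t ht,
      PiLp.inner_apply, Real.inner_apply, Fin.sum_univ_three]
    ring
  · by_contra! hdvd
    exact hirr.not_isUnit (hcop q dvd_rfl hdvd)

namespace IsRRMFOn

variable {I : Set ℝ} {r : ℝ → Space3} {f : Fin 3 → ℝ → Space3} {u : Space3} {c : ℝ}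

theorem exists_wronskian_mul_sq_eq (hI : IsOpen I) (hne : I.Nonempty) (hf : IsRRMFOn I r f)
    {p : Fin 3 → ℝ[X]} {q : ℝ[X]} (hpq : ∀ t ∈ I, ∀ i, (p i).eval t = q.eval t * f 0 t i)
    (hu : ‖u‖ = 1) (hc : ∀ t ∈ I, inner ℝ (f 0 t) u = c) :
    ∃ A B Q : ℝ[X], Q ≠ 0 ∧ A ^ 2 + B ^ 2 = C (1 - c ^ 2) * Q ^ 2 ∧ (wronskian A B * q) ^ 2 =
      C (c ^ 2 * (1 - c ^ 2)) * (∑ i, derivative (p i) ^ 2 - derivative q ^ 2) * Q ^ 4 := by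
  obtain ⟨t₀, ht₀⟩ := hne
  have hinf : I.Infinite := infinite_of_mem_nhds t₀ (hI.mem_nhds ht₀)
  have hnear : ∀ {P : ℝ → Prop}, (∀ t ∈ I, P t) → ∀ t ∈ I, ∀ᶠ s in 𝓝 t, P s :=
    fun hP t ht => eventually_of_mem (hI.mem_nhds ht) hP
  have hdiff : ∀ t ∈ I, ∀ k, HasDerivAt (f k) (deriv (f k) t) t := fun t ht k =>
    ((hf.rational k).differentiableAt (hI.mem_nhds ht)).hasDerivAt
  obtain ⟨A, B, Q, hABQ⟩ := ((hf.rational 1).inner_const u).exists_common_denominator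
    ((hf.rational 2).inner_const u)
  have hA : ∀ t ∈ I, A.eval t = Q.eval t * inner ℝ (f 1 t) u := fun t ht => by
    rw [(hABQ t ht).2.1, mul_div_cancel₀ _ (hABQ t ht).1]
  have hB : ∀ t ∈ I, B.eval t = Q.eval t * inner ℝ (f 2 t) u := fun t ht => by
    rw [(hABQ t ht).2.2, mul_div_cancel₀ _ (hABQ t ht).1]
  refine ⟨A, B, Q, ?_, eq_of_infinite_eval_eq _ _ (hinf.mono fun t ht => ?_),
    eq_of_infinite_eval_eq _ _ (hinf.mono fun t ht => ?_)⟩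
  · rintro rfl
    exact (hABQ t₀ ht₀).1 eval_zero
  · have hnormal := inner_sq_add_inner_sq_of_orthonormal (by simp) (hf.orthonormal t ht) u
    rw [hu, hc t ht, one_pow] at hnormal
    simp only [Set.mem_ofPred_eq, eval_add, eval_pow, eval_mul, eval_C, hA t ht, hB t ht]
    linear_combination (Q.eval t ^ 2) * hnormal
  · have hinner : ∀ k, HasDerivAt (fun s => inner ℝ (f k s) u) (inner ℝ (deriv (f k) t) u) t :=
      fun k => by simpa using (hdiff t ht k).inner ℝ (hasDerivAt_const t u)
    have hframe := inner_wronskian_sq_eq_of_rotation_minimizing (by simp) (hdiff t ht)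
      (hnear hf.orthonormal t ht) (hf.rotation_minimizing t ht) (hnear hc t ht)
    have hspeed := sum_eval_derivative_sq_eq_of_norm_eq_one (hdiff t ht 0)
      (hnear hf.adapted.1 t ht) (hnear hpq t ht)
    rw [hu, one_pow] at hframe
    simp only [Set.mem_ofPred_eq, eval_pow, eval_mul, eval_C, eval_sub, eval_finsetSum, hspeed,
      eval_wronskian_eq_of_eventually_eval_eq_mul (hinner 1) (hinner 2) (hnear hA t ht)
        (hnear hB t ht)]
    linear_combination (Q.eval t ^ 4 * q.eval t ^ 2) * hframe

theorem eq_zero_of_inner_eq_of_hasRationalDegreeOn_two (hI : IsOpen I) (hne : I.Nonempty)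
    (hf : IsRRMFOn I r f) (hdeg : HasRationalDegreeOn I (f 0) 2) (hu : ‖u‖ = 1)
    (hc : ∀ t ∈ I, inner ℝ (f 0 t) u = c) : c = 0 := by
  obtain ⟨p, q, hconic, hq, ⟨i, hi⟩, hpq⟩ := hdeg.exists_isSphericalConic
    (infinite_of_mem_nhds hne.some (hI.mem_nhds hne.some_mem)) hf.adapted.1 hu hc
  obtain ⟨A, B, Q, hQ, hAB, hW⟩ := hf.exists_wronskian_mul_sq_eq hI hne hpq hu hc
  exact hconic.eq_zero_of_irreducible hq hi hQ hAB hW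

end IsRRMFOn

theorem mainTheorem4_general {I : Set ℝ} (hI : IsOpen I) (hne : I.Nonempty) {r T : ℝ → Space3}
    (hT : IsUnitTangentOn I r T) (hdeg : HasRationalDegreeOn I T 2) {u : Space3} (hu : ‖u‖ = 1)
    {c : ℝ} (hc₀ : c ≠ 0) (hc : ∀ t ∈ I, inner ℝ (T t) u = c) :
    ¬ ∃ f : Fin 3 → ℝ → Space3, IsRRMFOn I r f := by
  rintro ⟨f, hf⟩
  have hinf : I.Infinite := infinite_of_mem_nhds hne.some (hI.mem_nhds hne.some_mem)
  rcases hT.eqOn_or_eqOn_neg hinf hf.adapted hdeg.isRationalVecOn (hf.rational 0) with h | h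
  · refine hc₀ (hf.eq_zero_of_inner_eq_of_hasRationalDegreeOn_two hI hne (hdeg.congr h) hu
      fun t ht => ?_)
    rw [h ht, hc t ht]
  · refine hc₀ (neg_eq_zero.1 (hf.eq_zero_of_inner_eq_of_hasRationalDegreeOn_two hI hne
      (hdeg.neg.congr h) hu fun t ht => ?_))
    rw [h ht, Pi.neg_apply, inner_neg_left, hc t ht]

theorem mainTheorem4 (I : Set ℝ) (hI : IsOpen I) (hne : I.Nonempty) (r T : ℝ → Space3)
    (hr : IsRationalHelixOn I r T) (hdeg : HasRationalDegreeOn I T 2) :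
    ¬ ∃ f : Fin 3 → ℝ → Space3, IsRRMFOn I r f := by
  obtain ⟨u, ψ, hu, hψ₀, hψπ, hψ, hang⟩ := hr.constant_angle
  refine mainTheorem4_general hI hne hr.tangent hdeg hu (fun hcos => hψ ?_) hang
  rw [← Real.arccos_cos hψ₀.le hψπ.le, hcos, Real.arccos_zero]
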